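/- A server holds $N$ files of $B$ bits each and serves $K$ users, $1\le K\le N$, over an error-free broadcast link; there are $\Lambda$ caches, each able to store $MB$ bits, and each user reads all the caches of some subset of $[\Lambda]=\{1,\dots,\Lambda\}$. A connectivity $b$ is a vector $(K_{\mathcal U,b})_{\mathcal U\subseteq[\Lambda]}$ of non-negative integers with sum $K$, where $K_{\mathcal U,b}$ is the number of users connected to exactly the caches in $\mathcal U$. An uncoded placement lets each cache store copies of at most $MB$ library bits; a placement guarantees load $R$ for $b$ if, for every choice of requested files, a broadcast of at most $RB$ bits allows every user to decode, without error, its requested file from the broadcast and the cached bits that it can read. For $\lambda\in\{1,\dots,\Lambda\}$ let $\mathcal B_\lambda$ be the set of connectivities in which every user is connected to exactly $\lambda$ caches. Let $\binom{\Lambda}{\lambda}$ divide $K$. Let $R^\star_{\mathrm{comb}}(M)$ be the infimum, over file sizes $B\ge1$ and uncoded placements, of the loads that can be guaranteed for the combinatorial topology, i.e. the connectivity in which each of the $\binom{\Lambda}{\lambda}$ sets of $\lambda$ caches is assigned to $K/\binom{\Lambda}{\lambda}$ users. Let $R^\star_{\mathrm{avg},\mathcal B_\lambda}(M)$ be the infimum,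 over file sizes $B\ge1$ and uncoded placements that are the same for all connectivities, of the average over $b\in\mathcal B_\lambda$ (all equiprobable) of the loads that can be guaranteed for $b$. Let $R_{\mathrm{avg},\mathcal B_\lambda,\mathrm{LB}}(M)$ be the piecewise linear curve with corner points $$\left(t\frac{N}{\Lambda},\ \frac{K\binom{\Lambda}{t+\lambda}}{\binom{\Lambda}{\lambda}\binom{\Lambda}{t}}+A_t\right),\quad t\in\{0,\dots,\Lambda-\lambda+1\},\qquad A_t=\frac{K}{|\mathcal B_\lambda|}\binom{\Lambda-t}{\lambda}\left(1-\frac{1}{\binom{t+\lambda}{\lambda}}\right).$$ Then for every $t\in\{1,\dots,\Lambda-\lambda\}$, with $M=tN/\Lambda$, $$A_t>0,\qquad R_{\mathrm{avg},\mathcal B_\lambda,\mathrm{LB}}(M)>R^\star_{\mathrm{comb}}(M),\qquad R^\star_{\mathrm{avg},\mathcal B_\lambda}(M)>R^\star_{\mathrm{comb}}(M).$$ -/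

import Mathlib

namespace MACC

/-! ### Connectivities -/

/-- A connectivity with `Λ` caches: for every set `U` of caches, the number `b U` of users that are
connected to exactly the caches in `U`. -/
abbrev Connectivity (Λ : ℕ) : Type := Finset (Fin Λ) → ℕ

/-- The users of a connectivity: `⟨U, k⟩` is the `k`-th user connected to exactly the caches
in `U`. -/
abbrev User {Λ : ℕ} (b : Connectivity Λ) : Type := Σ U : Finset (Fin Λ), Fin (b U)

/-- All connectivities with `Λ` caches and `K` users in total. -/
def allConnectivities (Λ K : ℕ) : Finset (Connectivity Λ) :=
  Finset.piAntidiag (Finset.univ : Finset (Finset (Fin Λ))) K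

open Classical in
/-- The ensemble of the connectivities with `Λ` caches and `K` users in which every user is
connected to exactly `lam` caches. -/
noncomputable def ensemble (Λ lam K : ℕ) : Finset (Connectivity Λ) :=
  (allConnectivities Λ K).filter (fun b => ∀ u : User b, u.1.card = lam)

/-- The generalized combinatorial topology: every set of `i` caches is assigned to exactly `Kc i`
users, for each `i` in `{0, …, Λ}`. -/
def combTopology (Λ : ℕ) (Kc : ℕ → ℕ) : Connectivity Λ := fun U => Kc U.card

/-- The combinatorial topology with `K` users, each of which is connected to exactly `lam` caches:
every set of `lam` caches is assigned to `K / (Λ choose lam)` users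
(meant for `(Λ choose lam) ∣ K`). -/
def uniformCombTopology (Λ lam K : ℕ) : Connectivity Λ :=
  combTopology Λ (fun i => if i = lam then K / Λ.choose lam else 0)

/-! ### Placement and delivery -/

/-- The content of a library of `N` files of `B` bits each. -/
abbrev Library (N B : ℕ) : Type := Fin N → Fin B → Bool

/-- An uncoded placement: each cache stores copies of some of the library bits; `(n, j)` is the
`j`-th bit of the `n`-th file. -/
abbrev Placement (Λ N B : ℕ) : Type := Fin Λ → Finset (Fin N × Fin B)

/-- Each cache holds at most `M * B` bits. -/
def FitsMemory {Λ N B : ℕ} (Z : Placement Λ N B) (M : ℝ) : Prop :=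
  ∀ l : Fin Λ, ((Z l).card : ℝ) ≤ M * B

/-- The positions of the bits that a user connected to the caches in `U` can read. -/
def accessible {Λ N B : ℕ} (Z : Placement Λ N B) (U : Finset (Fin Λ)) : Finset (Fin N × Fin B) :=
  U.biUnion Z

/-- For the demand `d`, a broadcast of `L` bits suffices: the server maps the library content to
`L` bits, and each user recovers its demanded file, without error and whatever the library content
is, from these `L` bits and the cached bits that it can read. -/
def CanDeliver {Λ N B : ℕ} (Z : Placement Λ N B) (b : Connectivity Λ) (d : User b → Fin N)
    (L : ℕ) : Prop :=
  ∃ (enc : Library N B → (Fin L → Bool))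
    (dec : ∀ u : User b,
      (Fin L → Bool) → ({p : Fin N × Fin B // p ∈ accessible Z u.1} → Bool) → (Fin B → Bool)),
    ∀ (W : Library N B) (u : User b), dec u (enc W) (fun p => W p.1.1 p.1.2) = W (d u)

/-- For every possible demand, a broadcast of `L` bits suffices. -/
def GuaranteesDelivery {Λ N B : ℕ} (Z : Placement Λ N B) (b : Connectivity Λ) (L : ℕ) : Prop :=
  ∀ d : User b → Fin N, CanDeliver Z b d L

/-! ### Optimal loads under uncoded placement -/

/-- With memory `M` (in files), the worst-case load `R` (in files) can be guaranteed for the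
connectivity `b` by some uncoded placement, for some file size `B`. -/
def Achievable (N : ℕ) {Λ : ℕ} (b : Connectivity Λ) (M R : ℝ) : Prop :=
  ∃ B : ℕ, 0 < B ∧ ∃ Z : Placement Λ N B, FitsMemory Z M ∧
    ∃ L : ℕ, GuaranteesDelivery Z b L ∧ (L : ℝ) / B ≤ R

/-- The optimal worst-case load of the connectivity `b`. -/
noncomputable def optLoad (N : ℕ) {Λ : ℕ} (b : Connectivity Λ) (M : ℝ) : ℝ :=
  sInf {R : ℝ | Achievable N b M R}

/-- With memory `M`, the worst-case load averaged over the equiprobable connectivities in `E` can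
be guaranteed to be at most `R`, by one uncoded placement that is fixed for all of them; the
delivery may depend on the connectivity. -/
def AvgAchievable (N : ℕ) {Λ : ℕ} (E : Finset (Connectivity Λ)) (M R : ℝ) : Prop :=
  ∃ B : ℕ, 0 < B ∧ ∃ Z : Placement Λ N B, FitsMemory Z M ∧
    ∃ L : Connectivity Λ → ℕ, (∀ b ∈ E, GuaranteesDelivery Z b (L b)) ∧
      (∑ b ∈ E, (L b : ℝ) / B) / E.card ≤ R

/-- The optimal average worst-case load over the ensemble `E`. -/
noncomputable def optAvgLoad (N : ℕ) {Λ : ℕ} (E : Finset (Connectivity Λ)) (M : ℝ) : ℝ :=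
  sInf {R : ℝ | AvgAchievable N E M R}

/-! ### The lower bound on the average load -/

/-- The term `A_t`. -/
noncomputable def excess (Λ lam K t : ℕ) : ℝ :=
  (K : ℝ) / (ensemble Λ lam K).card * (Λ - t).choose lam * (1 - 1 / ((t + lam).choose lam : ℝ))

/-- The value of the lower bound at the corner point of index `t`. -/
noncomputable def avgLoadLBCorner (Λ lam K t : ℕ) : ℝ :=
  (K : ℝ) * Λ.choose (t + lam) / (Λ.choose lam * Λ.choose t) + excess Λ lam K t

/-- The lower bound as a function of the memory `M`: the piecewise linear curve with corner points
`(t * N / Λ, avgLoadLBCorner Λ lam K t)` for `t = 0, …, Λ - lam + 1`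
(meant for `0 ≤ M ≤ (Λ - lam + 1) * N / Λ`). -/
noncomputable def avgLoadLB (N Λ lam K : ℕ) (M : ℝ) : ℝ :=
  (1 - Int.fract (Λ * M / N)) * avgLoadLBCorner Λ lam K ⌊Λ * M / N⌋₊ +
    Int.fract (Λ * M / N) * avgLoadLBCorner Λ lam K (⌊Λ * M / N⌋₊ + 1)

end MACC

namespace MACC

/-! ### Deliverability -/

/-! The corner value without `excess` is achieved for the combinatorial topology by coded
multicasting (`achievable_uniformCombTopology`), and `excess` is positive when `1 ≤ t ≤ Λ - lam`. It
remains to show that the corner value with `excess` bounds the average load from below.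

Fix a placement. For each connectivity, the acyclic index coding bound averaged over all orders of
the caches lets a bit held by exactly the caches `T` count for a user at `U` with the probability
that `U` precedes `T` (`sum_sum_mul_weight_le`). If all `K` users share one set `U`, every bit
outside `U` counts fully (`mul_sum_disjoint_le`). These few degenerate connectivities are the source
of `excess`.

Summing over the ensemble, symmetry among the sets `U` leaves a function `cornerBound` of the number
of holders of a bit (`card_mul_sum_cornerBound_le`). This function is convex and nonincreasing, so
its tangent line at `t` and the memory constraint finish the bound
(`avgLoadLBCorner_le_of_avgAchievable`). -/

theorem canDeliver_of_separating {Λ N B L : ℕ} {Z : Placement Λ N B} {b : Connectivity Λ}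
    {d : User b → Fin N} (enc : Library N B → (Fin L → Bool))
    (h : ∀ (W W' : Library N B) (u : User b), enc W = enc W' →
      (∀ p ∈ accessible Z u.1, W p.1 p.2 = W' p.1 p.2) → W (d u) = W' (d u)) :
    CanDeliver Z b d L := by
  classical
  -- The decoder answers with any library consistent with what the user sees; the default is never
  -- reached on genuine input.
  refine ⟨enc, fun u x y => if hx : ∃ W : Library N B, enc W = x ∧
    (fun p : {p : Fin N × Fin B // p ∈ accessible Z u.1} => W p.1.1 p.1.2) = y
    then hx.choose (d u) else fun _ => false, fun W u => ?_⟩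
  have hx : ∃ W' : Library N B, enc W' = enc W ∧
    (fun p : {p : Fin N × Fin B // p ∈ accessible Z u.1} => W' p.1.1 p.1.2) =
      fun p => W p.1.1 p.1.2 := ⟨W, rfl, rfl⟩
  simp only [dif_pos hx]
  exact h _ _ u hx.choose_spec.1 fun p hp => congrFun hx.choose_spec.2 ⟨p, hp⟩

/-- The acyclic index coding bound: if the bits in `P u` are wanted by `u` and hidden from every
user of at most the rank of `u`, then the broadcast has to be as long as all of them together. -/
theorem card_biUnion_le_of_canDeliver {Λ N B L : ℕ} {Z : Placement Λ N B} {b : Connectivity Λ}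
    {d : User b → Fin N} (hL : CanDeliver Z b d L) (r : User b → ℕ)
    (P : User b → Finset (Fin N × Fin B)) (hPd : ∀ u, ∀ p ∈ P u, p.1 = d u)
    (hP : ∀ u v, r u ≤ r v → Disjoint (P v) (accessible Z u.1)) :
    (Finset.univ.biUnion P).card ≤ L := by
  classical
  obtain ⟨enc, dec, hdec⟩ := hL
  set Q := Finset.univ.biUnion P with hQ
  let lift : (Q → Bool) → Library N B := fun x n j => if h : (n, j) ∈ Q then x ⟨(n, j), h⟩ else false
  have hinj : Function.Injective fun x => enc (lift x) := by
    intro x x' hxx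
    -- Users decode in order of rank: the bits of `Q` that `u` can read are wanted by users of
    -- smaller rank, so they already agree.
    have key : ∀ k, ∀ u, r u = k → ∀ p ∈ P u, lift x p.1 p.2 = lift x' p.1 p.2 := by
      intro k
      induction k using Nat.strong_induction_on with
      | _ k ih =>
        intro u hu p hp
        have hacc : (fun p : {p : Fin N × Fin B // p ∈ accessible Z u.1} =>
            lift x p.1.1 p.1.2) = fun p => lift x' p.1.1 p.1.2 := by
          funext ⟨q, hq⟩
          by_cases hqQ : q ∈ Q
          · obtain ⟨v, -, hv⟩ := Finset.mem_biUnion.1 hqQ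
            rcases lt_or_ge (r v) (r u) with hlt | hge
            · exact ih (r v) (hu ▸ hlt) v rfl q hv
            · exact absurd hq (Finset.disjoint_left.1 (hP u v hge) hv)
          · have : (q.1, q.2) ∉ Q := hqQ
            simp only [lift, dif_neg this]
        have h1 := hdec (lift x) u
        have h2 := hdec (lift x') u
        have hxx' : enc (lift x) = enc (lift x') := hxx
        rw [hacc, hxx', h2] at h1
        rw [hPd u p hp, h1]
    funext ⟨p, hp⟩
    obtain ⟨u, -, hu⟩ := Finset.mem_biUnion.1 hp
    have := key (r u) u rfl p hu
    have hp' : (p.1, p.2) ∈ Q := hp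
    simpa only [lift, dif_pos hp'] using this
  have := Fintype.card_le_of_injective _ hinj
  simp only [Fintype.card_fun, Fintype.card_bool, Fintype.card_coe, Fintype.card_fin] at this
  exact (Nat.pow_le_pow_iff_right (by norm_num)).1 this

theorem card_user {Λ : ℕ} (b : Connectivity Λ) : Fintype.card (User b) = ∑ U, b U := by
  simp [User]

/-- The acyclic index coding bound averaged over the cyclic shifts of a demand of distinct files. -/
theorem sum_mul_card_le {Λ N B L : ℕ} {Z : Placement Λ N B} {b : Connectivity Λ}
    (hb : ∑ U, b U ≤ N) (hN : 0 < N) (hL : GuaranteesDelivery Z b L) (r : Finset (Fin Λ) → ℕ)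
    (F : Finset (Fin Λ) → Finset (Fin N × Fin B))
    (hF : ∀ u v : User b, r u.1 ≤ r v.1 → Disjoint (F v.1) (accessible Z u.1)) :
    ∑ U, b U * (F U).card ≤ N * L := by
  classical
  have : NeZero N := ⟨hN.ne'⟩
  obtain ⟨e⟩ : Nonempty (User b ↪ Fin N) := by
    apply Function.Embedding.nonempty_of_card_le
    rw [card_user, Fintype.card_fin]; exact hb
  -- Distinct demands keep the wanted sets disjoint. Over all shifts `s`, each user requests each
  -- file exactly once.
  have hs : ∀ s : Fin N, ∑ u : User b, ((F u.1).filter fun p => p.1 = e u + s).card ≤ L := by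
    intro s
    have := card_biUnion_le_of_canDeliver (hL fun u => e u + s) (fun u => r u.1)
      (fun u => (F u.1).filter fun p => p.1 = e u + s)
      (fun u p hp => (Finset.mem_filter.1 hp).2)
      (fun u v huv => (hF u v huv).mono_left (Finset.filter_subset _ _))
    rwa [Finset.card_biUnion] at this
    intro u _ v _ huv
    refine Finset.disjoint_left.2 fun p hp hp' => huv (e.injective ?_)
    exact add_right_cancel ((Finset.mem_filter.1 hp).2.symm.trans (Finset.mem_filter.1 hp').2)
  calc ∑ U, b U * (F U).card = ∑ u : User b, (F u.1).card := by
        rw [Fintype.sum_sigma]; simp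
    _ = ∑ u : User b, ∑ s : Fin N, ((F u.1).filter fun p => p.1 = e u + s).card := by
        refine Finset.sum_congr rfl fun u _ => ?_
        rw [Finset.card_eq_sum_card_fiberwise (f := fun p => p.1 - e u) (t := Finset.univ)
          (fun _ _ => Finset.mem_coe.2 (Finset.mem_univ _))]
        refine Finset.sum_congr rfl fun s _ => ?_
        congr 1
        ext p
        simp [sub_eq_iff_eq_add, add_comm]
    _ = ∑ s : Fin N, ∑ u : User b, ((F u.1).filter fun p => p.1 = e u + s).card :=
        Finset.sum_comm
    _ ≤ ∑ _s : Fin N, L := Finset.sum_le_sum fun s _ => hs s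
    _ = N * L := by simp

/-! ### Binomial sequences -/

/-- Increments are monotone, so they can be compared with the one at `t` in both directions. This
replaces Jensen's inequality. -/
theorem tangent_le_of_convex {a : ℕ → ℝ} (ha : ∀ s, 2 * a (s + 1) ≤ a s + a (s + 2)) (t s : ℕ) :
    a t + (a (t + 1) - a t) * ((s : ℝ) - t) ≤ a s := by
  have hm : Monotone fun s => a (s + 1) - a s :=
    monotone_nat_of_le_succ fun n => by linarith [ha n]
  rcases le_total t s with h | h
  · induction s, h using Nat.le_induction with
    | base => simp
    | succ n hn ih =>
      have := hm hn
      push_cast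
      simp only at this
      linarith
  · obtain ⟨k, rfl⟩ := Nat.exists_eq_add_of_le h
    clear h
    induction k generalizing s with
    | zero => simp
    | succ k ih =>
      have h1 := ih (s + 1)
      rw [show s + 1 + k = s + (k + 1) by ring] at h1
      have h2 := hm (show s ≤ s + (k + 1) by omega)
      push_cast at h1 ⊢
      simp only at h2
      linarith

/-- The drop of the product is `(a s - a (s + 1)) * c s + a (s + 1) * (c s - c (s + 1))`, and all
four factors are nonnegative and nonincreasing. -/
theorem mul_convex {a c : ℕ → ℝ} (ha0 : ∀ s, 0 ≤ a s) (hc0 : ∀ s, 0 ≤ c s)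
    (ha1 : ∀ s, a (s + 1) ≤ a s) (hc1 : ∀ s, c (s + 1) ≤ c s)
    (ha : ∀ s, 2 * a (s + 1) ≤ a s + a (s + 2)) (hc : ∀ s, 2 * c (s + 1) ≤ c s + c (s + 2))
    (s : ℕ) : 2 * (a (s + 1) * c (s + 1)) ≤ a s * c s + a (s + 2) * c (s + 2) := by
  have h1 : (a (s + 1) - a (s + 2)) * c (s + 1) ≤ (a s - a (s + 1)) * c s :=
    mul_le_mul (by linarith [ha s]) (hc1 s) (hc0 _) (by linarith [ha1 s])
  have h2 : a (s + 2) * (c (s + 1) - c (s + 2)) ≤ a (s + 1) * (c s - c (s + 1)) :=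
    mul_le_mul (ha1 _) (by linarith [hc s]) (by linarith [hc1 (s + 1)]) (ha0 _)
  nlinarith

theorem choose_sub_antitone (n k s : ℕ) :
    ((n - (s + 1)).choose k : ℝ) ≤ ((n - s).choose k : ℝ) := by
  exact_mod_cast Nat.choose_le_choose k (by omega)

theorem choose_sub_convex (n : ℕ) {k : ℕ} (hk : 1 ≤ k) (s : ℕ) :
    2 * ((n - (s + 1)).choose k : ℝ) ≤ ((n - s).choose k : ℝ) + ((n - (s + 2)).choose k : ℝ) := by
  obtain ⟨k, rfl⟩ := Nat.exists_eq_add_of_le' hk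
  rcases lt_or_ge n (s + 2) with h | h
  -- Truncated subtraction makes the middle term vanish here.
  · have : (n - (s + 1)).choose (k + 1) = 0 := by
      rw [show n - (s + 1) = 0 by omega]; simp
    rw [this, Nat.cast_zero, mul_zero]; positivity
  · obtain ⟨m, rfl⟩ := Nat.exists_eq_add_of_le' h
    rw [show m + (s + 2) - (s + 1) = m + 1 by omega, show m + (s + 2) - s = m + 1 + 1 by omega,
      show m + (s + 2) - (s + 2) = m by omega, Nat.choose_succ_succ (m + 1), Nat.choose_succ_succ m]
    have : (m.choose k : ℝ) ≤ ((m + 1).choose k : ℝ) := by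
      exact_mod_cast Nat.choose_le_choose k (by omega)
    push_cast
    linarith

theorem inv_choose_succ (k s : ℕ) :
    (1 : ℝ) / ((s + 1 + k).choose k : ℝ) =
      1 / ((s + k).choose k : ℝ) * ((s + 1) / (s + 1 + k)) := by
  have h := Nat.choose_mul_succ_eq (s + k) k
  rw [show s + k + 1 - k = s + 1 by omega, show s + k + 1 = s + 1 + k by omega] at h
  have h' : ((s + k).choose k : ℝ) * (s + 1 + k) = ((s + 1 + k).choose k : ℝ) * (s + 1) := by
    exact_mod_cast h
  have h1 : ((s + k).choose k : ℝ) ≠ 0 := by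
    exact_mod_cast (Nat.choose_pos (by omega : k ≤ s + k)).ne'
  have h2 : ((s + 1 + k).choose k : ℝ) ≠ 0 := by
    exact_mod_cast (Nat.choose_pos (by omega : k ≤ s + 1 + k)).ne'
  have h3 : (s + 1 + k : ℝ) ≠ 0 := by positivity
  field_simp
  linarith

theorem inv_choose_antitone (k s : ℕ) :
    (1 : ℝ) / ((s + 1 + k).choose k : ℝ) ≤ 1 / ((s + k).choose k : ℝ) := by
  rw [inv_choose_succ]
  apply mul_le_of_le_one_right (by positivity)
  rw [div_le_one (by positivity)]
  linarith [(Nat.cast_nonneg k : (0 : ℝ) ≤ k)]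

/-- By `inv_choose_succ` the drop at `s` is the term at `s` times `k / (s + 1 + k)`, a product of
nonincreasing factors. -/
theorem inv_choose_convex (k s : ℕ) :
    2 * ((1 : ℝ) / ((s + 1 + k).choose k : ℝ)) ≤
      1 / ((s + k).choose k : ℝ) + 1 / ((s + 2 + k).choose k : ℝ) := by
  have h1 := inv_choose_succ k (s + 1)
  have h2 := inv_choose_succ k s
  have h3 := inv_choose_antitone k s
  set x := (1 : ℝ) / ((s + k).choose k : ℝ)
  set y := (1 : ℝ) / ((s + 1 + k).choose k : ℝ)
  rw [show s + 1 + 1 + k = s + 2 + k by ring] at h1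
  have hy : 0 ≤ y := by positivity
  have e1 : y - 1 / ((s + 2 + k).choose k : ℝ) = y * (k / (s + 2 + k)) := by
    rw [h1]; push_cast; field_simp; ring
  have e2 : x - y = x * (k / (s + 1 + k)) := by
    rw [h2]; field_simp; ring
  have : y * ((k : ℝ) / (s + 2 + k)) ≤ x * (k / (s + 1 + k)) := by
    gcongr
    norm_num
  linarith

/-! ### Orders of the caches -/

open Finset in
theorem exists_initial_subset {Λ : ℕ} (π : Equiv.Perm (Fin Λ)) (S : Finset (Fin Λ)) :
    ∀ k ≤ S.card, ∃ U ⊆ S, U.card = k ∧ ∀ u ∈ U, ∀ l ∈ S \ U, π u < π l := by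
  intro k
  induction k with
  | zero => exact fun _ => ⟨∅, by simp⟩
  | succ k ih =>
    intro hk
    obtain ⟨U, hUS, hUk, hU⟩ := ih (by omega)
    have hne : (S \ U).Nonempty := by
      rw [← card_pos, card_sdiff_of_subset hUS]; omega
    obtain ⟨m, hm, hmin⟩ := exists_min_image (S \ U) π hne
    rw [mem_sdiff] at hm
    refine ⟨insert m U, insert_subset hm.1 hUS, by rw [card_insert_of_notMem hm.2, hUk], ?_⟩
    intro u hu l hl
    rw [mem_sdiff, mem_insert, not_or] at hl
    have hl' : l ∈ S \ U := mem_sdiff.2 ⟨hl.1, hl.2.2⟩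
    rcases mem_insert.1 hu with rfl | hu
    · exact lt_of_le_of_ne (hmin l hl') fun h => hl.2.1 (π.injective h).symm
    · exact hU u hu l hl'

/-- The orders of the caches in which all of `U` come before all of `T`. -/
def ordersBefore {Λ : ℕ} (U T : Finset (Fin Λ)) : Finset (Equiv.Perm (Fin Λ)) :=
  Finset.univ.filter fun π => ∀ u ∈ U, ∀ l ∈ T, π u < π l

/-- A relabelling of the caches, used to show that all subsets of `S` of one size are equally likely
to come first in a random order. -/
theorem exists_perm_image_eq {Λ : ℕ} {S U V : Finset (Fin Λ)} (hU : U ⊆ S) (hV : V ⊆ S)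
    (h : U.card = V.card) :
    ∃ σ : Equiv.Perm (Fin Λ), (∀ x ∈ V, σ x ∈ U) ∧ (∀ x ∈ S \ V, σ x ∈ S \ U) := by
  classical
  have e1 : {x // x ∈ V} ≃ {x // x ∈ U} := Finset.equivOfCardEq h.symm
  have e2 : {x // x ∈ S \ V} ≃ {x // x ∈ S \ U} := Finset.equivOfCardEq (by
    rw [Finset.card_sdiff_of_subset hU, Finset.card_sdiff_of_subset hV, h])
  let f : Fin Λ → Fin Λ := fun x =>
    if h : x ∈ V then e1 ⟨x, h⟩ else if h : x ∈ S \ V then e2 ⟨x, h⟩ else x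
  have hfV : ∀ x (h : x ∈ V), f x = e1 ⟨x, h⟩ := fun x h => by simp only [f, dif_pos h]
  have hfS : ∀ x (h : x ∈ S \ V), f x = e2 ⟨x, h⟩ := fun x h => by
    simp only [f, dif_neg (Finset.mem_sdiff.1 h).2, dif_pos h]
  have hfN : ∀ x, x ∉ S → f x = x := fun x h => by
    have h1 : x ∉ V := fun h' => h (hV h')
    have h2 : x ∉ S \ V := fun h' => h (Finset.mem_sdiff.1 h').1
    simp only [f, dif_neg h1, dif_neg h2]
  have mV : ∀ x, x ∈ V → f x ∈ U := fun x h => by rw [hfV x h]; exact (e1 _).2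
  have mS : ∀ x, x ∈ S \ V → f x ∈ S \ U := fun x h => by rw [hfS x h]; exact (e2 _).2
  have hinj : Function.Injective f := by
    intro x y hxy
    have cases3 : ∀ z, z ∈ V ∨ z ∈ S \ V ∨ z ∉ S := fun z => by
      by_cases z ∈ V <;> by_cases z ∈ S <;> simp_all
    have mN : ∀ x, x ∉ S → f x ∉ S := fun x h => by rwa [hfN x h]
    rcases cases3 x with hx | hx | hx <;> rcases cases3 y with hy | hy | hy
    · rw [hfV x hx, hfV y hy] at hxy
      simpa using e1.injective (Subtype.ext hxy)
    · exact absurd (hxy ▸ mV x hx) (Finset.mem_sdiff.1 (mS y hy)).2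
    · exact absurd (hU (hxy ▸ mV x hx)) (mN y hy)
    · exact absurd (hxy ▸ mV y hy) (Finset.mem_sdiff.1 (mS x hx)).2
    · rw [hfS x hx, hfS y hy] at hxy
      simpa using e2.injective (Subtype.ext hxy)
    · exact absurd (Finset.mem_sdiff.1 (hxy ▸ mS x hx)).1 (mN y hy)
    · exact absurd (hU (hxy ▸ mV y hy)) (mN x hx)
    · exact absurd (Finset.mem_sdiff.1 (hxy ▸ mS y hy)).1 (mN x hx)
    · rwa [hfN x hx, hfN y hy] at hxy
  refine ⟨Equiv.ofBijective f (Finite.injective_iff_bijective.1 hinj), mV, mS⟩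

/-- Each order puts some `V` of size `U.card` first within `U ∪ T`; there are binomially many
candidates `V`, and relabelling injects the orders for `V` into those for `U`. -/
theorem factorial_le_choose_mul_card_ordersBefore {Λ : ℕ} {U T : Finset (Fin Λ)}
    (hUT : Disjoint U T) :
    Λ.factorial ≤ (T.card + U.card).choose U.card * (ordersBefore U T).card := by
  classical
  have hcard : (U ∪ T).card = T.card + U.card := by
    rw [Finset.card_union_of_disjoint hUT, add_comm]
  have hcov : (Finset.univ : Finset (Equiv.Perm (Fin Λ))) ⊆
      ((U ∪ T).powersetCard U.card).biUnion fun V => ordersBefore V ((U ∪ T) \ V) := by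
    intro π _
    obtain ⟨V, hV, hVc, h⟩ := exists_initial_subset π (U ∪ T) U.card (by omega)
    exact Finset.mem_biUnion.2 ⟨V, Finset.mem_powersetCard.2 ⟨hV, hVc⟩,
      Finset.mem_filter.2 ⟨Finset.mem_univ _, h⟩⟩
  have hle : ∀ V ∈ (U ∪ T).powersetCard U.card,
      (ordersBefore V ((U ∪ T) \ V)).card ≤ (ordersBefore U T).card := by
    intro V hV
    obtain ⟨hV, hVc⟩ := Finset.mem_powersetCard.1 hV
    obtain ⟨σ, h1, h2⟩ := exists_perm_image_eq hV Finset.subset_union_left hVc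
    refine Finset.card_le_card_of_injOn (fun π => π * σ) ?_ (fun _ _ _ _ h => mul_right_cancel h)
    intro π hπ
    have hπ := (Finset.mem_filter.1 (Finset.mem_coe.1 hπ)).2
    refine Finset.mem_coe.2 (Finset.mem_filter.2 ⟨Finset.mem_univ _, fun u hu l hl => ?_⟩)
    exact hπ _ (h1 u hu) _ (h2 l (Finset.mem_sdiff.2
      ⟨Finset.mem_union_right _ hl, Finset.disjoint_right.1 hUT hl⟩))
  have := (Finset.card_le_card hcov).trans Finset.card_biUnion_le
  rw [Finset.card_univ, Fintype.card_perm, Fintype.card_fin] at this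
  refine this.trans ((Finset.sum_le_card_nsmul _ _ _ hle).trans ?_)
  rw [Finset.card_powersetCard, hcard, smul_eq_mul]

/-! ### The combinatorial scheme -/

theorem card_filter_mem_powersetCard_le {Λ t : ℕ} (l : Fin Λ) :
    (((Finset.univ : Finset (Fin Λ)).powersetCard t).filter fun T => l ∈ T).card ≤
      (Λ - 1).choose (t - 1) := by
  classical
  have : ((Finset.univ.erase l).powersetCard (t - 1)).card = (Λ - 1).choose (t - 1) := by
    rw [Finset.card_powersetCard, Finset.card_erase_of_mem (Finset.mem_univ _)]; simp
  rw [← this]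
  refine Finset.card_le_card_of_injOn (fun T => T.erase l) ?_ ?_
  · intro T hT
    simp only [Finset.coe_filter, Set.mem_ofPred_eq, Finset.mem_powersetCard] at hT
    simp only [Finset.mem_coe, Finset.mem_powersetCard]
    exact ⟨Finset.erase_subset_erase _ (Finset.subset_univ _), by
      rw [Finset.card_erase_of_mem hT.2, hT.1.2]⟩
  · intro T hT T' hT' h
    simp only [Finset.coe_filter, Set.mem_ofPred_eq] at hT hT'
    simp only at h
    rw [← Finset.insert_erase hT.2, h, Finset.insert_erase hT'.2]

/-- The decoding step of coded multicasting: all summands but one are known and cancel. -/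
theorem eq_of_sum_eq {ι M : Type*} [AddCancelCommMonoid M] (s : Finset ι) (f g : ι → M) {i : ι}
    (hi : i ∈ s) (h : ∑ j ∈ s, f j = ∑ j ∈ s, g j) (hfg : ∀ j ∈ s, j ≠ i → f j = g j) :
    f i = g i := by
  classical
  rw [← Finset.add_sum_erase s f hi, ← Finset.add_sum_erase s g hi,
    Finset.sum_congr rfl fun j hj => hfg j (Finset.mem_of_mem_erase hj) (Finset.ne_of_mem_erase hj)]
    at h
  exact add_right_cancel h

/-- The placement in which the `j`-th bit of every file is stored in the caches in `τ j`. -/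
def patternPlacement {Λ N B : ℕ} (τ : Fin B → Finset (Fin Λ)) : Placement Λ N B := fun l =>
  Finset.univ ×ˢ Finset.univ.filter fun j => l ∈ τ j

theorem mem_accessible_patternPlacement {Λ N B : ℕ} {τ : Fin B → Finset (Fin Λ)}
    {U : Finset (Fin Λ)} {p : Fin N × Fin B} :
    p ∈ accessible (patternPlacement τ) U ↔ ∃ l ∈ U, l ∈ τ p.2 := by
  simp [accessible, patternPlacement]

/-- Coded multicasting: one bit is sent for every set of `t + lam` caches and every index of users
that share the same caches. -/
theorem guaranteesDelivery_patternPlacement {Λ N B L lam t k : ℕ} {b : Connectivity Λ}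
    (hb : ∀ u : User b, u.1.card = lam) (hk : ∀ U, b U ≤ k)
    (τ : Fin B → Finset (Fin Λ)) (hτ : Function.Injective τ) (hτt : ∀ j, (τ j).card = t)
    (σ : Fin L → Finset (Fin Λ) × ℕ)
    (hσ : ∀ S : Finset (Fin Λ), S.card = t + lam → ∀ i < k, ∃ x, σ x = (S, i)) :
    GuaranteesDelivery (patternPlacement τ : Placement Λ N B) b L := by
  classical
  intro d
  let val : Bool → ZMod 2 := fun c => if c then 1 else 0
  have hval : Function.Injective val := by decide
  -- For `σ x = (S, i)`, the bit sent is the XOR, over all splittings of `S` into a user's caches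
  -- and a pattern `τ j`, of the `j`-th bit wanted by the `i`-th user there.
  let I : Fin L → Finset (User b × Fin B) := fun x => Finset.univ.filter fun q =>
    Disjoint q.1.1 (τ q.2) ∧ q.1.1 ∪ τ q.2 = (σ x).1 ∧ (q.1.2 : ℕ) = (σ x).2
  refine canDeliver_of_separating
    (fun W x => decide (∑ q ∈ I x, val (W (d q.1) q.2) = 0)) fun W W' u hW hacc => ?_
  funext j
  by_cases hdis : Disjoint u.1 (τ j)
  swap
  · obtain ⟨l, hl, hl'⟩ := Finset.not_disjoint_iff.1 hdis
    exact hacc (d u, j) (mem_accessible_patternPlacement.2 ⟨l, hl, hl'⟩)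
  obtain ⟨x, hx⟩ := hσ (u.1 ∪ τ j) (by
    rw [Finset.card_union_of_disjoint hdis, hb, hτt, add_comm]) u.2 (u.2.2.trans_le (hk _))
  have hsum : ∑ q ∈ I x, val (W (d q.1) q.2) = ∑ q ∈ I x, val (W' (d q.1) q.2) := by
    have h01 : ∀ y z : ZMod 2, decide (y = 0) = decide (z = 0) → y = z := by decide
    exact h01 _ _ (congrFun hW x)
  refine hval (eq_of_sum_eq (I x) (fun q => val (W (d q.1) q.2)) (fun q => val (W' (d q.1) q.2))
    (i := (u, j)) (by simp [I, hx, hdis]) hsum fun q hq hne => ?_)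
  obtain ⟨⟨V, i⟩, j'⟩ := q
  simp only [I, hx, Finset.mem_filter, Finset.mem_univ, true_and] at hq
  obtain ⟨hq1, hq2, hq3⟩ := hq
  -- Any other summand belongs to a user at a different set of the same size, so `u` has a cache in
  -- `S \ V = τ j'` and reads that bit.
  have hV : ¬ u.1 ⊆ V := by
    intro hsub
    obtain ⟨U, i'⟩ := u
    have hUV : U = V := Finset.eq_of_subset_of_card_le hsub (by
      rw [hb ⟨U, i'⟩, hb ⟨V, i⟩])
    subst hUV
    apply hne
    have h1 : j' = j := hτ (by
      rw [← Finset.union_sdiff_cancel_left hq1, hq2, Finset.union_sdiff_cancel_left hdis])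
    rw [h1, Fin.ext hq3]
  obtain ⟨l, hl, hlV⟩ := Finset.not_subset.1 hV
  have hl' : l ∈ τ j' := by
    have : l ∈ V ∪ τ j' := hq2 ▸ Finset.mem_union_left _ hl
    exact (Finset.mem_union.1 this).resolve_left hlV
  exact congrArg val (hacc (d ⟨V, i⟩, j') (mem_accessible_patternPlacement.2 ⟨l, hl, hl'⟩))

/-- Each file has one bit per `t`-set of caches. A cache then holds at most a fraction `(Λ -
1).choose (t - 1) / Λ.choose t = t / Λ` of the library. -/
theorem achievable_uniformCombTopology {Λ N lam K t : ℕ} (ht : 1 ≤ t) (htΛ : t ≤ Λ)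
    (hdvd : Λ.choose lam ∣ K) :
    Achievable N (uniformCombTopology Λ lam K) ((t : ℝ) * N / Λ)
      ((K : ℝ) * Λ.choose (t + lam) / (Λ.choose lam * Λ.choose t)) := by
  classical
  set k := K / Λ.choose lam with hk
  let 𝒯 := (Finset.univ : Finset (Fin Λ)).powersetCard t
  let 𝒮 := (Finset.univ : Finset (Fin Λ)).powersetCard (t + lam) ×ˢ Finset.range k
  have h𝒯 : 𝒯.card = Λ.choose t := by simp [𝒯]
  have h𝒮 : 𝒮.card = Λ.choose (t + lam) * k := by simp [𝒮]
  let τ : Fin (Λ.choose t) → Finset (Fin Λ) := fun j => ((𝒯.equivFinOfCardEq h𝒯).symm j).1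
  let σ : Fin (Λ.choose (t + lam) * k) → Finset (Fin Λ) × ℕ := fun x =>
    ((𝒮.equivFinOfCardEq h𝒮).symm x).1
  have hτ : Function.Injective τ := Subtype.val_injective.comp (Equiv.injective _)
  have hτm : ∀ j, τ j ∈ 𝒯 := fun j => ((𝒯.equivFinOfCardEq h𝒯).symm j).2
  have hB : 0 < Λ.choose t := Nat.choose_pos htΛ
  refine ⟨Λ.choose t, hB, patternPlacement τ, ?_, Λ.choose (t + lam) * k,
    guaranteesDelivery_patternPlacement (lam := lam) (t := t) (k := k) ?_ ?_ τ hτ ?_ σ ?_, ?_⟩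
  · intro l
    have h1 : (Finset.univ.filter fun j => l ∈ τ j).card ≤ (Λ - 1).choose (t - 1) := by
      refine le_trans ?_ (card_filter_mem_powersetCard_le l)
      refine Finset.card_le_card_of_injOn τ (fun j hj => ?_) hτ.injOn
      simp only [Finset.coe_filter, Set.mem_ofPred_eq, Finset.mem_univ, true_and] at hj ⊢
      exact ⟨hτm j, hj⟩
    have h2 : (Λ : ℝ) * (Λ - 1).choose (t - 1) = Λ.choose t * t := by
      have := Nat.add_one_mul_choose_eq (Λ - 1) (t - 1)
      rw [show Λ - 1 + 1 = Λ by omega, show t - 1 + 1 = t by omega] at this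
      exact_mod_cast this
    have hΛ : (0 : ℝ) < Λ := by exact_mod_cast (by omega : 0 < Λ)
    have h3 : ((Finset.univ.filter fun j => l ∈ τ j).card : ℝ) ≤ (Λ - 1).choose (t - 1) := by
      exact_mod_cast h1
    rw [patternPlacement, Finset.card_product, Finset.card_univ, Fintype.card_fin, Nat.cast_mul,
      div_mul_eq_mul_div, le_div_iff₀ hΛ]
    calc _ ≤ (N : ℝ) * (Λ - 1).choose (t - 1) * Λ := by gcongr
      _ = N * (Λ * (Λ - 1).choose (t - 1)) := by ring
      _ = _ := by rw [h2]; ring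
  · rintro ⟨U, i⟩
    by_contra hU
    have : uniformCombTopology Λ lam K U = 0 := by
      simp only [uniformCombTopology, combTopology]; exact if_neg hU
    exact (this ▸ i).elim0
  · intro U
    simp only [uniformCombTopology, combTopology]
    split_ifs <;> simp [hk]
  · intro j
    exact (Finset.mem_powersetCard.1 (hτm j)).2
  · intro S hS i hi
    have hmem : (S, i) ∈ 𝒮 := by simp [𝒮, hS, hi]
    exact ⟨𝒮.equivFinOfCardEq h𝒮 ⟨_, hmem⟩, by simp [σ]⟩
  · obtain ⟨m, rfl⟩ := hdvd
    rcases Nat.eq_zero_or_pos (Λ.choose lam) with h0 | h0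
    · simp [hk, h0]
    · rw [hk, Nat.mul_div_cancel_left _ h0]
      have : (Λ.choose lam : ℝ) ≠ 0 := by exact_mod_cast h0.ne'
      have : (Λ.choose t : ℝ) ≠ 0 := by exact_mod_cast hB.ne'
      push_cast
      apply le_of_eq
      field_simp

/-! ### The ensemble -/

theorem mem_ensemble {Λ lam K : ℕ} {b : Connectivity Λ} :
    b ∈ ensemble Λ lam K ↔ ∑ U, b U = K ∧ ∀ U, b U ≠ 0 → U.card = lam := by
  classical
  simp only [ensemble, allConnectivities, Finset.mem_filter, Finset.mem_piAntidiag]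
  refine and_congr (by simp) ⟨fun h U hU => h ⟨U, ⟨0, Nat.pos_of_ne_zero hU⟩⟩, fun h u => ?_⟩
  exact h u.1 (u.2.pos).ne'

theorem single_mem_ensemble {Λ lam K : ℕ} {U : Finset (Fin Λ)} (hU : U.card = lam) :
    (Pi.single U K : Connectivity Λ) ∈ ensemble Λ lam K := by
  rw [mem_ensemble]
  refine ⟨by simp [Finset.sum_pi_single'], fun V hV => ?_⟩
  by_cases h : V = U
  · rw [h, hU]
  · exact absurd (by simp [h]) hV

/-- Makes the coefficient of the inverse binomial in `cornerBound` nonnegative, on which its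
convexity rests. -/
theorem choose_le_card_ensemble {Λ lam K : ℕ} (hK : 0 < K) :
    Λ.choose lam ≤ (ensemble Λ lam K).card := by
  have : ((Finset.univ : Finset (Fin Λ)).powersetCard lam).card = Λ.choose lam := by simp
  rw [← this]
  refine Finset.card_le_card_of_injOn (fun U => (Pi.single U K : Connectivity Λ)) ?_ ?_
  · exact fun U hU => single_mem_ensemble (Finset.mem_powersetCard.1 hU).2
  · intro U _ V _ h
    by_contra hne
    have := congrFun h U
    simp only [Pi.single_eq_same, Pi.single_eq_of_ne hne] at this
    omega

theorem sum_ensemble_apply_eq {Λ lam K : ℕ} {U V : Finset (Fin Λ)} (hU : U.card = lam)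
    (hV : V.card = lam) : ∑ b ∈ ensemble Λ lam K, b U = ∑ b ∈ ensemble Λ lam K, b V := by
  classical
  -- The swap exchanges the two sets as labels; it need not come from a permutation of the caches.
  have hmem : ∀ b ∈ ensemble Λ lam K, b ∘ Equiv.swap U V ∈ ensemble Λ lam K := by
    intro b hb
    rw [mem_ensemble] at hb ⊢
    refine ⟨(Equiv.sum_comp (Equiv.swap U V) b).trans hb.1, fun W hW => ?_⟩
    have := hb.2 _ hW
    rcases eq_or_ne W U with rfl | h1
    · exact hU
    rcases eq_or_ne W V with rfl | h2
    · exact hV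
    rwa [Equiv.swap_apply_of_ne_of_ne h1 h2] at this
  refine Finset.sum_nbij' (fun b => b ∘ Equiv.swap U V) (fun b => b ∘ Equiv.swap U V) hmem hmem
    ?_ ?_ ?_
  · intro b _; funext W; simp
  · intro b _; funext W; simp
  · intro b _; simp

theorem choose_mul_sum_ensemble_apply {Λ lam K : ℕ} {U : Finset (Fin Λ)} (hU : U.card = lam) :
    Λ.choose lam * ∑ b ∈ ensemble Λ lam K, b U = (ensemble Λ lam K).card * K := by
  classical
  calc Λ.choose lam * ∑ b ∈ ensemble Λ lam K, b U
      = ∑ V ∈ (Finset.univ : Finset (Fin Λ)).powersetCard lam, ∑ b ∈ ensemble Λ lam K, b V := by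
        rw [Finset.sum_congr rfl fun V hV =>
          sum_ensemble_apply_eq (Finset.mem_powersetCard.1 hV).2 hU]
        simp
    _ = ∑ V, ∑ b ∈ ensemble Λ lam K, b V := by
        refine Finset.sum_subset (Finset.subset_univ _) fun V _ hV => ?_
        refine Finset.sum_eq_zero fun b hb => ?_
        by_contra h
        exact hV (Finset.mem_powersetCard.2 ⟨Finset.subset_univ _, (mem_ensemble.1 hb).2 V h⟩)
    _ = ∑ b ∈ ensemble Λ lam K, ∑ V, b V := Finset.sum_comm
    _ = _ := by
        rw [Finset.sum_congr rfl fun b hb => (mem_ensemble.1 hb).1]; simp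

/-! ### Lower bounds for a fixed placement -/

/-- The caches that store the bit `p`. -/
def holders {Λ N B : ℕ} (Z : Placement Λ N B) (p : Fin N × Fin B) : Finset (Fin Λ) :=
  Finset.univ.filter fun l => p ∈ Z l

theorem mem_holders {Λ N B : ℕ} {Z : Placement Λ N B} {p : Fin N × Fin B} {l : Fin Λ} :
    l ∈ holders Z p ↔ p ∈ Z l := by simp [holders]

theorem sum_card_holders {Λ N B : ℕ} (Z : Placement Λ N B) :
    ∑ p, (holders Z p).card = ∑ l, (Z l).card := by
  classical
  have := Finset.sum_card_bipartiteAbove_eq_sum_card_bipartiteBelow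
    (s := (Finset.univ : Finset (Fin N × Fin B))) (t := (Finset.univ : Finset (Fin Λ)))
    (fun p l => p ∈ Z l)
  simpa [Finset.bipartiteAbove, Finset.bipartiteBelow, holders] using this

/-- The probability that all of `U` come before all of `T` in a random order and that `U` and `T`
are disjoint. -/
noncomputable def weight {Λ : ℕ} (U T : Finset (Fin Λ)) : ℝ :=
  if Disjoint U T then 1 / ((T.card + U.card).choose U.card : ℝ) else 0

theorem factorial_mul_weight_le {Λ : ℕ} (U T : Finset (Fin Λ)) :
    (Λ.factorial : ℝ) * weight U T ≤ (ordersBefore U T).card := by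
  unfold weight
  split_ifs with h
  · have hpos : (0 : ℝ) < ((T.card + U.card).choose U.card : ℝ) := by
      exact_mod_cast Nat.choose_pos (by omega)
    rw [mul_one_div, div_le_iff₀ hpos, mul_comm]
    exact_mod_cast factorial_le_choose_mul_card_ordersBefore h
  · simp

open Classical in
-- Users are ranked by the position of their last cache. A bit whose holders all come after `U` is
-- hidden from every user whose last cache is no later than that of `U`.
theorem sum_mul_card_ordersBefore_le {Λ N B L : ℕ} {Z : Placement Λ N B} {b : Connectivity Λ}
    (hb : ∑ U, b U ≤ N) (hN : 0 < N) (hne : ∀ u : User b, u.1.Nonempty)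
    (hL : GuaranteesDelivery Z b L) (π : Equiv.Perm (Fin Λ)) :
    ∑ U, b U * (Finset.univ.filter fun p => π ∈ ordersBefore U (holders Z p)).card ≤ N * L := by
  refine sum_mul_card_le hb hN hL (fun U => U.sup fun l => (π l : ℕ)) _ fun u v huv => ?_
  refine Finset.disjoint_left.2 fun p hp hpu => ?_
  obtain ⟨l, hl, hpl⟩ := Finset.mem_biUnion.1 hpu
  obtain ⟨m, hm, hmv⟩ := Finset.exists_mem_eq_sup v.1 (hne v) fun l => (π l : ℕ)
  have h1 : (π l : ℕ) ≤ u.1.sup fun l => (π l : ℕ) := Finset.le_sup (f := fun l => (π l : ℕ)) hl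
  have h2 : π m < π l :=
    (Finset.mem_filter.1 (Finset.mem_filter.1 hp).2).2 m hm l (mem_holders.2 hpl)
  rw [Fin.lt_def] at h2
  omega

theorem sum_sum_mul_weight_le {Λ N B L : ℕ} {Z : Placement Λ N B} {b : Connectivity Λ}
    (hb : ∑ U, b U ≤ N) (hN : 0 < N) (hne : ∀ u : User b, u.1.Nonempty)
    (hL : GuaranteesDelivery Z b L) :
    ∑ U, (b U : ℝ) * ∑ p, weight U (holders Z p) ≤ (N : ℝ) * L := by
  classical
  have h1 : ∑ U, b U * ∑ p, (ordersBefore U (holders Z p)).card ≤ Λ.factorial * (N * L) := by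
    calc ∑ U, b U * ∑ p, (ordersBefore U (holders Z p)).card
        = ∑ U, b U * ∑ π : Equiv.Perm (Fin Λ),
            (Finset.univ.filter fun p => π ∈ ordersBefore U (holders Z p)).card := by
          refine Finset.sum_congr rfl fun U _ => ?_
          congr 1
          have := Finset.sum_card_bipartiteAbove_eq_sum_card_bipartiteBelow
            (s := (Finset.univ : Finset (Fin N × Fin B)))
            (t := (Finset.univ : Finset (Equiv.Perm (Fin Λ))))
            (fun p π => π ∈ ordersBefore U (holders Z p))
          simpa [Finset.bipartiteAbove, Finset.bipartiteBelow] using this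
      _ = ∑ π : Equiv.Perm (Fin Λ), ∑ U, b U *
            (Finset.univ.filter fun p => π ∈ ordersBefore U (holders Z p)).card := by
          simp_rw [Finset.mul_sum]
          exact Finset.sum_comm
      _ ≤ ∑ _π : Equiv.Perm (Fin Λ), N * L :=
          Finset.sum_le_sum fun π _ => sum_mul_card_ordersBefore_le hb hN hne hL π
      _ = _ := by simp [Fintype.card_perm]
  have hfac : (0 : ℝ) < Λ.factorial := by exact_mod_cast Nat.factorial_pos Λ
  refine le_of_mul_le_mul_left ?_ hfac
  calc (Λ.factorial : ℝ) * ∑ U, (b U : ℝ) * ∑ p, weight U (holders Z p)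
      = ∑ U, (b U : ℝ) * ∑ p, (Λ.factorial : ℝ) * weight U (holders Z p) := by
        simp_rw [Finset.mul_sum]
        refine Finset.sum_congr rfl fun U _ => Finset.sum_congr rfl fun p _ => by ring
    _ ≤ ∑ U, (b U : ℝ) * ∑ p, ((ordersBefore U (holders Z p)).card : ℝ) := by
        gcongr
        exact factorial_mul_weight_le _ _
    _ ≤ _ := by exact_mod_cast h1

open Classical in
-- All users read the same bits, so a constant rank is admissible and no order of the caches is
-- needed.
theorem mul_sum_disjoint_le {Λ N B L K : ℕ} {Z : Placement Λ N B} {U : Finset (Fin Λ)}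
    (hK : K ≤ N) (hN : 0 < N) (hL : GuaranteesDelivery Z (Pi.single U K : Connectivity Λ) L) :
    (K : ℝ) * ∑ p, (if Disjoint U (holders Z p) then (1 : ℝ) else 0) ≤ (N : ℝ) * L := by
  have hU : ∀ u : User (Pi.single U K : Connectivity Λ), u.1 = U := by
    rintro ⟨V, i⟩
    by_contra h
    have h0 : (Pi.single U K : Connectivity Λ) V = 0 := by
      rw [Pi.single_apply, if_neg h]
    exact (h0 ▸ i).elim0
  have := sum_mul_card_le (by simpa [Finset.sum_pi_single'] using hK) hN hL (fun _ => 0)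
    (fun V => Finset.univ.filter fun p => Disjoint V (holders Z p)) (fun u v _ => by
      rw [hU u, hU v]
      refine Finset.disjoint_left.2 fun p hp hpU => ?_
      obtain ⟨l, hl, hpl⟩ := Finset.mem_biUnion.1 hpU
      exact Finset.disjoint_left.1 (Finset.mem_filter.1 hp).2 hl (mem_holders.2 hpl))
  rw [Finset.sum_eq_single U (fun V _ hV => by rw [Pi.single_eq_of_ne hV, zero_mul]) (by simp),
    Pi.single_eq_same] at this
  rw [Finset.sum_boole]
  exact_mod_cast this

open Classical in
theorem sum_powersetCard_disjoint {Λ : ℕ} (lam : ℕ) (T : Finset (Fin Λ)) (c : ℝ) :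
    ∑ U ∈ (Finset.univ : Finset (Fin Λ)).powersetCard lam, (if Disjoint U T then c else 0) =
      (Λ - T.card).choose lam * c := by
  have : ((Finset.univ : Finset (Fin Λ)).powersetCard lam).filter (fun U => Disjoint U T) =
      Tᶜ.powersetCard lam := by
    ext U
    simp [Finset.mem_powersetCard, Finset.subset_compl_iff_disjoint_right, and_comm]
  rw [← Finset.sum_filter, this]
  simp [Finset.card_compl]

theorem sum_powersetCard_weight {Λ : ℕ} (lam : ℕ) (T : Finset (Fin Λ)) :
    ∑ U ∈ (Finset.univ : Finset (Fin Λ)).powersetCard lam, weight U T =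
      (Λ - T.card).choose lam * (1 / ((T.card + lam).choose lam : ℝ)) := by
  classical
  rw [← sum_powersetCard_disjoint]
  refine Finset.sum_congr rfl fun U hU => ?_
  rw [weight, (Finset.mem_powersetCard.1 hU).2]

/-! ### The lower bound on the average load -/

/-- The lower bound on the average load at the corner point of index `s`, in a form that shows its
convexity. -/
noncomputable def cornerBound (Λ lam K s : ℕ) : ℝ :=
  K * ((Λ - s).choose lam * ((1 / (Λ.choose lam : ℝ) - 1 / (ensemble Λ lam K).card) *
    (1 / ((s + lam).choose lam : ℝ)) + 1 / (ensemble Λ lam K).card))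

theorem card_mul_sum_cornerBound_le {Λ N B lam K : ℕ} {Z : Placement Λ N B}
    {L : Connectivity Λ → ℕ} (hlam : 1 ≤ lam) (hlamΛ : lam ≤ Λ) (hK : 0 < K) (hKN : K ≤ N)
    (hL : ∀ b ∈ ensemble Λ lam K, GuaranteesDelivery Z b (L b)) :
    ((ensemble Λ lam K).card : ℝ) * ∑ p, cornerBound Λ lam K (holders Z p).card ≤
      N * ∑ b ∈ ensemble Λ lam K, (L b : ℝ) := by
  classical
  set E := ensemble Λ lam K with hE
  let D := (Finset.univ : Finset (Fin Λ)).powersetCard lam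
  let w : Finset (Fin Λ) → ℝ := fun U => ∑ p, weight U (holders Z p)
  let x : Finset (Fin Λ) → ℝ := fun U => ∑ p, if Disjoint U (holders Z p) then (1 : ℝ) else 0
  have hC : (0 : ℝ) < Λ.choose lam := by exact_mod_cast Nat.choose_pos hlamΛ
  have hEpos : (0 : ℝ) < E.card := by
    exact_mod_cast (Nat.choose_pos hlamΛ).trans_le (choose_le_card_ensemble hK)
  have hN : 0 < N := hK.trans_le hKN
  -- Both bounds in one formula: the second sum upgrades `w U` to `x U` when all users sit at `U`,
  -- and vanishes otherwise.
  have hb : ∀ b ∈ E, ∑ U, (b U : ℝ) * w U +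
      ∑ U ∈ D, (if b = Pi.single U K then (K : ℝ) * (x U - w U) else 0) ≤ N * L b := by
    intro b hbE
    obtain ⟨hsum, hcard⟩ := mem_ensemble.1 hbE
    by_cases hex : ∃ V ∈ D, b = Pi.single V K
    · obtain ⟨V, hV, rfl⟩ := hex
      have hne : ∀ U, U ≠ V → (Pi.single V K : Connectivity Λ) ≠ Pi.single U K := by
        intro U hU h
        have := congrFun h V
        rw [Pi.single_eq_same, Pi.single_eq_of_ne hU.symm] at this
        omega
      rw [Finset.sum_eq_single V (fun U _ hU => by
          rw [Pi.single_eq_of_ne hU, Nat.cast_zero, zero_mul]) (by simp),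
        Finset.sum_eq_single V (fun U _ hU => if_neg (hne U hU)) (fun h => absurd hV h),
        if_pos rfl, Pi.single_eq_same]
      have := mul_sum_disjoint_le hKN hN (hL _ hbE)
      calc (K : ℝ) * w V + K * (x V - w V) = K * x V := by ring
        _ ≤ _ := this
    · rw [Finset.sum_eq_zero (s := D) fun U hU => if_neg fun h => hex ⟨U, hU, h⟩, add_zero]
      refine sum_sum_mul_weight_le (hsum.trans_le hKN) hN (fun u => ?_) (hL b hbE)
      rw [← Finset.card_pos, hcard _ u.2.pos.ne']
      exact hlam
  -- By symmetry a set in `D` has `K / Λ.choose lam` users on average.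
  have h1 : ∑ b ∈ E, ∑ U, (b U : ℝ) * w U = ∑ U ∈ D, (E.card * K / Λ.choose lam : ℝ) * w U := by
    rw [Finset.sum_comm]
    simp_rw [← Finset.sum_mul]
    symm
    rw [← Finset.sum_subset (Finset.subset_univ D)]
    · refine Finset.sum_congr rfl fun U hU => ?_
      congr 1
      rw [div_eq_iff hC.ne', mul_comm _ (Λ.choose lam : ℝ)]
      exact_mod_cast (choose_mul_sum_ensemble_apply (Finset.mem_powersetCard.1 hU).2).symm
    · intro U _ hU
      rw [Finset.sum_eq_zero, zero_mul]
      intro b hbE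
      by_contra h
      exact hU (Finset.mem_powersetCard.2 ⟨Finset.subset_univ _,
        (mem_ensemble.1 hbE).2 U (by exact_mod_cast h)⟩)
  have h2 : ∑ b ∈ E, ∑ U ∈ D, (if b = Pi.single U K then (K : ℝ) * (x U - w U) else 0) =
      ∑ U ∈ D, (K : ℝ) * (x U - w U) := by
    rw [Finset.sum_comm]
    refine Finset.sum_congr rfl fun U hU => ?_
    rw [Finset.sum_ite_eq', if_pos (single_mem_ensemble (Finset.mem_powersetCard.1 hU).2)]
  have h3 : ∑ U ∈ D, w U = ∑ p, ((Λ - (holders Z p).card).choose lam : ℝ) *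
      (1 / (((holders Z p).card + lam).choose lam : ℝ)) := by
    rw [Finset.sum_comm]
    exact Finset.sum_congr rfl fun p _ => sum_powersetCard_weight lam _
  have h4 : ∑ U ∈ D, x U = ∑ p, ((Λ - (holders Z p).card).choose lam : ℝ) * 1 := by
    rw [Finset.sum_comm]
    exact Finset.sum_congr rfl fun p _ => sum_powersetCard_disjoint lam _ 1
  have := Finset.sum_le_sum hb
  rw [Finset.sum_add_distrib, h1, h2, ← Finset.mul_sum, ← Finset.mul_sum,
    Finset.sum_sub_distrib, h3, h4, ← Finset.mul_sum] at this
  refine le_trans (le_of_eq ?_) this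
  simp only [Finset.mul_sum, ← Finset.sum_sub_distrib, ← Finset.sum_add_distrib, cornerBound, ← hE]
  refine Finset.sum_congr rfl fun p _ => ?_
  field_simp
  ring

/-- `cornerBound` is a product of nonnegative, nonincreasing convex sequences. The sign of the slope
matters because the memory constraint is only an inequality. -/
theorem cornerBound_tangent {Λ lam K : ℕ} (hlam : 1 ≤ lam) (hlamΛ : lam ≤ Λ) (hK : 0 < K) (t : ℕ) :
    ∃ m ≤ (0 : ℝ), ∀ s : ℕ, cornerBound Λ lam K t + m * ((s : ℝ) - t) ≤ cornerBound Λ lam K s := by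
  have hC : (0 : ℝ) < Λ.choose lam := by exact_mod_cast Nat.choose_pos hlamΛ
  have hCE : (Λ.choose lam : ℝ) ≤ (ensemble Λ lam K).card := by
    exact_mod_cast choose_le_card_ensemble hK
  set α := 1 / (Λ.choose lam : ℝ) - 1 / (ensemble Λ lam K).card with hα
  set β := 1 / ((ensemble Λ lam K).card : ℝ) with hβ
  have hα0 : 0 ≤ α := sub_nonneg.2 (one_div_le_one_div_of_le hC hCE)
  have hβ0 : 0 ≤ β := by positivity
  let a : ℕ → ℝ := fun s => (Λ - s).choose lam
  let c : ℕ → ℝ := fun s => α * (1 / ((s + lam).choose lam : ℝ)) + β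
  have ha0 : ∀ s, 0 ≤ a s := fun s => by positivity
  have hc0 : ∀ s, 0 ≤ c s := fun s => by positivity
  have ha1 : ∀ s, a (s + 1) ≤ a s := choose_sub_antitone Λ lam
  have hc1 : ∀ s, c (s + 1) ≤ c s := fun s => by
    have := mul_le_mul_of_nonneg_left (inv_choose_antitone lam s) hα0
    simp only [c]
    linarith
  have hc2 : ∀ s, 2 * c (s + 1) ≤ c s + c (s + 2) := fun s => by
    have := mul_le_mul_of_nonneg_left (inv_choose_convex lam s) hα0
    simp only [c]
    linarith
  have hg : ∀ s, cornerBound Λ lam K s = K * (a s * c s) := fun s => rfl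
  have hK0 : (0 : ℝ) ≤ K := Nat.cast_nonneg K
  refine ⟨_, ?_, tangent_le_of_convex (fun s => ?_) t⟩
  · rw [hg, hg, ← mul_sub]
    refine mul_nonpos_of_nonneg_of_nonpos hK0 (sub_nonpos.2 ?_)
    exact mul_le_mul (ha1 t) (hc1 t) (hc0 _) (ha0 _)
  · have := mul_le_mul_of_nonneg_left
      (mul_convex ha0 hc0 ha1 hc1 (choose_sub_convex Λ hlam) hc2 s) hK0
    rw [hg, hg, hg]
    linarith

theorem cornerBound_eq {Λ lam K t : ℕ} (htΛ : t + lam ≤ Λ) :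
    cornerBound Λ lam K t = avgLoadLBCorner Λ lam K t := by
  -- Both sides count pairs of disjoint sets of sizes `t` and `lam`.
  have h1 : (Λ.choose (t + lam) : ℝ) * (t + lam).choose lam =
      Λ.choose t * (Λ - t).choose lam := by
    have := Nat.choose_mul (n := Λ) (k := t + lam) (s := t) (Nat.le_add_right t lam)
    rw [Nat.add_sub_cancel_left, Nat.choose_symm_add] at this
    exact_mod_cast this
  have hC : (Λ.choose lam : ℝ) ≠ 0 := by
    exact_mod_cast (Nat.choose_pos (by omega : lam ≤ Λ)).ne'
  have hC2 : (Λ.choose t : ℝ) ≠ 0 := by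
    exact_mod_cast (Nat.choose_pos (by omega : t ≤ Λ)).ne'
  have hC3 : ((t + lam).choose lam : ℝ) ≠ 0 := by
    exact_mod_cast (Nat.choose_pos (by omega : lam ≤ t + lam)).ne'
  have h2 : (Λ.choose (t + lam) : ℝ) =
      Λ.choose t * (Λ - t).choose lam / (t + lam).choose lam := by
    rw [eq_div_iff hC3, h1]
  rw [cornerBound, avgLoadLBCorner, excess, h2, div_eq_mul_one_div (K : ℝ)]
  generalize (1 : ℝ) / ((ensemble Λ lam K).card : ℝ) = β
  field_simp
  ring

theorem avgLoadLBCorner_le_of_avgAchievable {Λ N lam K t : ℕ} (hlam : 1 ≤ lam) (hK : 0 < K)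
    (hKN : K ≤ N) (htΛ : t + lam ≤ Λ) {R : ℝ}
    (hR : AvgAchievable N (ensemble Λ lam K) ((t : ℝ) * N / Λ) R) :
    avgLoadLBCorner Λ lam K t ≤ R := by
  obtain ⟨B, hB, Z, hZ, L, hL, hLR⟩ := hR
  refine le_trans ?_ hLR
  have hlamΛ : lam ≤ Λ := by omega
  have hE : (0 : ℝ) < (ensemble Λ lam K).card := by
    exact_mod_cast (Nat.choose_pos hlamΛ).trans_le (choose_le_card_ensemble hK)
  have hΛ : (0 : ℝ) < Λ := by exact_mod_cast (by omega : 0 < Λ)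
  have hN : (0 : ℝ) < N := by exact_mod_cast hK.trans_le hKN
  have hB' : (0 : ℝ) < B := by exact_mod_cast hB
  rw [← Finset.sum_div, le_div_iff₀ hE, le_div_iff₀ hB', ← cornerBound_eq htΛ]
  obtain ⟨m, hm, htan⟩ := cornerBound_tangent (K := K) hlam hlamΛ hK t
  have hmem : ∑ p, ((holders Z p).card : ℝ) ≤ t * (N * B) := by
    calc ∑ p, ((holders Z p).card : ℝ) = ∑ l, ((Z l).card : ℝ) := by
          exact_mod_cast sum_card_holders Z
      _ ≤ ∑ _l : Fin Λ, (t : ℝ) * N / Λ * B := Finset.sum_le_sum fun l _ => hZ l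
      _ = t * (N * B) := by
          rw [Finset.sum_const, Finset.card_univ, Fintype.card_fin, nsmul_eq_mul]
          field_simp
  have hsum : (N * B : ℝ) * cornerBound Λ lam K t ≤
      ∑ p, cornerBound Λ lam K (holders Z p).card := by
    have h := Finset.sum_le_sum fun (p : Fin N × Fin B) (_ : p ∈ Finset.univ) =>
      htan (holders Z p).card
    rw [Finset.sum_add_distrib, ← Finset.mul_sum, Finset.sum_sub_distrib] at h
    simp only [Finset.sum_const, Finset.card_univ, Fintype.card_prod, Fintype.card_fin,
      nsmul_eq_mul, Nat.cast_mul] at h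
    have h' : 0 ≤ m * (∑ p, ((holders Z p).card : ℝ) - N * B * t) :=
      mul_nonneg_of_nonpos_of_nonpos hm (by linarith)
    linarith
  have hmain := card_mul_sum_cornerBound_le hlam hlamΛ hK hKN hL
  refine le_of_mul_le_mul_left ?_ hN
  calc (N : ℝ) * (cornerBound Λ lam K t * (ensemble Λ lam K).card * B)
      = (ensemble Λ lam K).card * ((N * B : ℝ) * cornerBound Λ lam K t) := by ring
    _ ≤ _ := mul_le_mul_of_nonneg_left hsum hE.le
    _ ≤ _ := hmain

/-- The infimum of the empty set would be the default `0`. With empty caches and one-bit files,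
broadcasting the whole library works. -/
theorem exists_avgAchievable {Λ N : ℕ} (E : Finset (Connectivity Λ)) {M : ℝ} (hM : 0 ≤ M) :
    ∃ R, AvgAchievable N E M R := by
  classical
  refine ⟨_, 1, one_pos, fun _ => ∅, fun l => by simpa using hM, fun _ => N,
    fun b _ d => ⟨fun W n => W n 0, fun u x _ _ => x (d u), fun W u => ?_⟩, le_rfl⟩
  funext j
  rw [Subsingleton.elim j 0]

theorem excess_pos {Λ lam K t : ℕ} (hlam : 1 ≤ lam) (hK : 0 < K) (ht : 1 ≤ t)
    (htΛ : t + lam ≤ Λ) : 0 < excess Λ lam K t := by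
  have hE : 0 < (ensemble Λ lam K).card :=
    (Nat.choose_pos (by omega : lam ≤ Λ)).trans_le (choose_le_card_ensemble hK)
  have h1 : 0 < (Λ - t).choose lam := Nat.choose_pos (by omega)
  have h2 : 1 < (t + lam).choose lam := by
    obtain ⟨k, rfl⟩ := Nat.exists_eq_add_of_le' hlam
    rw [← add_assoc, Nat.choose_succ_succ]
    have := Nat.choose_pos (by omega : k ≤ t + k)
    have := Nat.choose_pos (by omega : k + 1 ≤ t + k)
    simp only [Nat.succ_eq_add_one]
    omega
  have h3 : (1 : ℝ) / ((t + lam).choose lam : ℝ) < 1 := by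
    rw [div_lt_one (by exact_mod_cast (zero_lt_one.trans h2))]
    exact_mod_cast h2
  have h4 : 0 < 1 - (1 : ℝ) / ((t + lam).choose lam : ℝ) := sub_pos.2 h3
  unfold excess
  positivity

theorem optLoad_le {Λ N : ℕ} {b : Connectivity Λ} {M R : ℝ} (h : Achievable N b M R) :
    optLoad N b M ≤ R := by
  refine csInf_le ⟨0, ?_⟩ h
  rintro _ ⟨B, _, _, _, L, _, hR⟩
  exact le_trans (by positivity) hR

theorem avgLoadLB_corner {N Λ : ℕ} (lam K t : ℕ) (hN : 0 < N) (hΛ : 0 < Λ) :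
    avgLoadLB N Λ lam K ((t : ℝ) * N / Λ) = avgLoadLBCorner Λ lam K t := by
  have hN' : (N : ℝ) ≠ 0 := by exact_mod_cast hN.ne'
  have hΛ' : (Λ : ℝ) ≠ 0 := by exact_mod_cast hΛ.ne'
  have : (Λ : ℝ) * ((t : ℝ) * N / Λ) / N = t := by field_simp
  rw [avgLoadLB, this, Int.fract_natCast, Nat.floor_natCast]
  ring

end MACC

theorem corollary2 (Λ N lam K t : ℕ) (hlam : lam ∈ Finset.Icc 1 Λ) (hK : 0 < K) (hKN : K ≤ N)
    (hdvd : Λ.choose lam ∣ K) (ht : t ∈ Finset.Icc 1 (Λ - lam)) :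
    0 < MACC.excess Λ lam K t ∧
    MACC.optLoad N (MACC.uniformCombTopology Λ lam K) ((t : ℝ) * N / Λ) <
      MACC.avgLoadLB N Λ lam K ((t : ℝ) * N / Λ) ∧
    MACC.optLoad N (MACC.uniformCombTopology Λ lam K) ((t : ℝ) * N / Λ) <
      MACC.optAvgLoad N (MACC.ensemble Λ lam K) ((t : ℝ) * N / Λ) := by
  rw [Finset.mem_Icc] at hlam ht
  have htΛ : t + lam ≤ Λ := by omega
  have hexc := MACC.excess_pos hlam.1 hK ht.1 htΛ
  have hcomb : MACC.optLoad N (MACC.uniformCombTopology Λ lam K) ((t : ℝ) * N / Λ) <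
      MACC.avgLoadLBCorner Λ lam K t :=
    (MACC.optLoad_le (MACC.achievable_uniformCombTopology ht.1 (by omega) hdvd)).trans_lt
      (lt_add_of_pos_right _ hexc)
  refine ⟨hexc, ?_, hcomb.trans_le ?_⟩
  · rwa [MACC.avgLoadLB_corner lam K t (hK.trans_le hKN) (by omega)]
  · exact le_csInf (MACC.exists_avgAchievable _ (by positivity)) fun R hR =>
      MACC.avgLoadLBCorner_le_of_avgAchievable hlam.1 hK hKN htΛ hR
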